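/- **Theorem (Kolmogorov–Chentsov).** Let $(T,d_T)$ and $(E,d_E)$ be extended pseudo-metric spaces (distances may be $+\infty$, and distinct points may be at distance $0$), with $E$ equipped with its Borel $\sigma$-algebra. For $\varepsilon>0$ let $N_\varepsilon(T)$ be the minimal cardinality of a set $S\subseteq T$ such that every $t\in T$ satisfies $d_T(s,t)\le\varepsilon$ for some $s\in S$. Let $c>0$, $d>0$, $p>0$, $q>d$ be real numbers, and assume that $N_\varepsilon(T)\le c\,\varepsilon^{-d}$ for all real $\varepsilon\in(0,\operatorname{diam}(T)]$. Let $M\ge 0$, and let $X=(X_t)_{t\in T}$ be an $E$-valued process on a probability space $(\Omega,\mathcal F,\mathbf P)$ that satisfies the Kolmogorov condition for exponents $(p,q)$ with constant $M$: for all $s,t\in T$ the pair $(X_s,X_t):\Omega\to E\times E$ is measurable for the Borel $\sigma$-algebra of $E\times E$, and $$\mathbf E\big[d_E(X_s,X_t)^p\big]\le M\,d_T(s,t)^q ;$$ or, more generally, let $X$ be a modification of such a process (a process $Y$ is a modification of $X$ if for every $t\in T$, $Y_t=X_t$ almost surely). 1. For every $\beta\in(0,(q-d)/p)$ there is a finite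 constant $L=L(T,c,d,p,q,\beta)$, which does not depend on $E$, on the probability space, on $X$ or on $M$, such that for every countable subset $T'\subseteq T$, $$\mathbf E\left[\sup_{s,t\in T'}\frac{d_E(X_s,X_t)^p}{d_T(s,t)^{\beta p}}\right]\le M\,L(T,c,d,p,q,\beta),$$ with the convention $0/0=0$. 2. If in addition $E$ is complete and $T$ is second-countable, then $X$ has a modification $Y$, with every $Y_t$ measurable, all of whose paths $t\mapsto Y_t(\omega)$, $\omega\in\Omega$, are Hölder continuous of exponent $\beta$ for all $\beta\in(0,(q-d)/p)$ simultaneously, that is, for every such $\beta$ there is a finite $C=C(\omega,\beta)$ with $d_E(Y_s(\omega),Y_t(\omega))\le C\,d_T(s,t)^\beta$ for all $s,t\in T$. -/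

import Mathlib

open MeasureTheory ProbabilityTheory
open scoped ENNReal NNReal

/-- The set `A` has bounded covering number with constant `c` and exponent `d`: for all radii
`ε ∈ (0, diam A]`, the minimal number of points of `A` whose closed `ε`-balls cover `A` is at most
`c * ε ^ (-d)`. -/
def HasBoundedCoveringNumber {T : Type*} [PseudoEMetricSpace T] (A : Set T) (c : ℝ≥0) (d : ℝ) :
    Prop :=
  ∀ ε : ℝ≥0, 0 < ε → (ε : ℝ≥0∞) ≤ Metric.ediam A →
    (Metric.coveringNumber ε A : ℝ≥0∞) ≤ c * (ε : ℝ≥0∞) ^ (-d)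

/-- The process `Y` is a modification of `X`: for every index `t`, almost surely `Y t = X t`. -/
def IsModificationOf {T Ω E : Type*} [MeasurableSpace Ω] (Y X : T → Ω → E) (P : Measure Ω) :
    Prop :=
  ∀ t, Y t =ᵐ[P] X t

/-!
The diameter `δ` of the index space is finite, because a nonempty space cannot be covered by fewer
than one ball. At each scale `δ / 2 ^ k` there is a cover by at most a multiple of `2 ^ (d * k)`
points. Summing the Kolmogorov condition over all pairs of nearby points of such a cover would cost
the square of this number and require `2 * d < q`; pair reduction (`EMetric.pair_reduction`) gets by
with linearly many pairs, at the price of distances longer by a factor linear in `k`. This is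
`exists_aemeasurable_edist_rpow_le`, and it produces for each scale `k` a random variable `G k`,
with integral of order `M * k ^ q * 2 ^ ((d - q) * k)`, which dominates the `p`-th powers of the
increments at that scale.

The weighted sum `W = ∑' k, 2 ^ (β * p * k) * G k` has finite integral as soon as `β * p < q - d`.
By definition of `W` the increments at scale `k` are at most `2 * W ^ (1 / p) * 2 ^ (-β * k)`, so
telescoping along the covers (`edist_le_of_chaining`) bounds the `p`-th power of the Hölder seminorm
on a countable set by a constant times `W`. Working with `W` instead of a norm in `L^p` treats
`p < 1` and `p ≥ 1` alike. Convergence of the telescoping sums to the process holds almost surely by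
the Borel–Cantelli type lemma `IsAEKolmogorovProcess.ae_tendsto`.

For the modification, the Hölder constants on a countable dense set are almost surely finite for a
sequence of exponents increasing to `(q - d) / p`. On this event the process is extended by limits,
which exist since `E` is complete; elsewhere it is replaced by a constant. The extension is Hölder
for the same exponents, hence for all smaller ones because `T` is bounded.
-/

section

open Filter Topology

/-! ### Spaces with bounded covering number -/

namespace HasBoundedCoveringNumber
variable {T : Type*} [PseudoEMetricSpace T] {c : ℝ≥0} {d : ℝ}

/-- Were the diameter infinite, the covering number bound would hold for arbitrarily large `ε`,
where `c * ε ^ (-d) < 1`, although a nonempty space needs at least one ball. -/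
lemma ediam_ne_top (hT : HasBoundedCoveringNumber (Set.univ : Set T) c d) (hd : 0 < d) :
    Metric.ediam (Set.univ : Set T) ≠ ∞ := by
  intro htop
  have hne : (Set.univ : Set T).Nonempty := by
    by_contra h
    simp [Set.not_nonempty_iff_eq_empty.mp h] at htop
  have hpos : (0 : ℝ≥0) < (c + 1) ^ d⁻¹ := NNReal.rpow_pos (by positivity)
  have h := hT ((c + 1) ^ d⁻¹) hpos (by simp [htop])
  have h1 : (1 : ℝ≥0∞) ≤ (Metric.coveringNumber ((c + 1) ^ d⁻¹) (Set.univ : Set T) : ℝ≥0∞) := by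
    have : (1 : ℕ∞) ≤ Metric.coveringNumber ((c + 1) ^ d⁻¹) (Set.univ : Set T) := by
      rw [Order.one_le_iff_pos]
      simpa using hne
    exact_mod_cast this
  have h2 : (((c + 1) ^ d⁻¹ : ℝ≥0) : ℝ≥0∞) ^ (-d) = ((c + 1 : ℝ≥0) : ℝ≥0∞)⁻¹ := by
    rw [ENNReal.coe_rpow_of_nonneg _ (inv_nonneg.mpr hd.le), ← ENNReal.rpow_mul, mul_neg,
      inv_mul_cancel₀ hd.ne', ENNReal.rpow_neg_one]
  rw [h2, ← div_eq_mul_inv] at h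
  have h3 : (c : ℝ≥0∞) / ((c + 1 : ℝ≥0) : ℝ≥0∞) < 1 := by
    rw [ENNReal.div_lt_iff (by simp) (by simp), one_mul]
    exact_mod_cast lt_add_one c
  exact absurd (h1.trans h) (not_le.mpr h3)

lemma exists_finset (hT : HasBoundedCoveringNumber (Set.univ : Set T) c d) {ε : ℝ≥0} (hε : 0 < ε)
    (hle : (ε : ℝ≥0∞) ≤ Metric.ediam (Set.univ : Set T)) :
    ∃ S : Finset T, (∀ t, ∃ s ∈ S, edist t s ≤ ε) ∧ (S.card : ℝ≥0∞) ≤ c * (ε : ℝ≥0∞) ^ (-d) := by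
  have h := hT ε hε hle
  have hfin : Metric.coveringNumber ε (Set.univ : Set T) ≠ ⊤ := by
    intro h'
    rw [h', ENat.toENNReal_top, top_le_iff] at h
    exact ENNReal.mul_ne_top (by simp) (by simp [ENNReal.rpow_eq_top_iff, hε.ne']) h
  refine ⟨Metric.finite_minimalCover (ε := ε) (A := Set.univ).toFinset, fun t ↦ ?_, ?_⟩
  · obtain ⟨s, hs, hts⟩ := Metric.isCover_minimalCover hfin (Set.mem_univ t)
    exact ⟨s, by simpa using hs, hts⟩
  · rw [← Metric.encard_minimalCover hfin,
      (Metric.finite_minimalCover (ε := ε) (A := Set.univ)).encard_eq_coe_toFinset_card] at h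
    simpa using h

end HasBoundedCoveringNumber

/-! ### Increments of a Kolmogorov process on a finite set -/

/-- The increments of length at most `ρ` inside a finite set `A` are dominated by one random
variable whose integral is of order `A.card` rather than `A.card ^ 2`, up to the logarithmic factor
`m ^ q`: by pair reduction it is enough to sum over at most `2 * A.card` pairs at distance at most
`m * ρ`. -/
lemma exists_aemeasurable_edist_rpow_le {T Ω E : Type*} [PseudoEMetricSpace T]
    [PseudoEMetricSpace E] [MeasurableSpace Ω] {P : Measure Ω} {X : T → Ω → E} {p q : ℝ} {M : ℝ≥0}
    (hX : IsAEKolmogorovProcess X P p q M) (A : Finset T) (m : ℕ) (hA : A.card ≤ 2 ^ m)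
    (ρ : ℝ≥0∞) :
    ∃ G : Ω → ℝ≥0∞, AEMeasurable G P ∧ ∫⁻ ω, G ω ∂P ≤ M * (2 * A.card * (m * ρ) ^ q) ∧
      ∀ ω, ∀ s ∈ A, ∀ t ∈ A, edist s t ≤ ρ → edist (X s ω) (X t ω) ^ p ≤ 2 ^ p * G ω := by
  obtain ⟨K, -, hK, hKρ, hKE⟩ := EMetric.pair_reduction (a := 2) (n := m) (J := A)
    (by exact_mod_cast hA) ρ E
  refine ⟨fun ω ↦ ∑ x ∈ K, edist (X x.1 ω) (X x.2 ω) ^ p, ?_, ?_, ?_⟩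
  · exact Finset.aemeasurable_fun_sum _ fun x _ ↦ hX.aemeasurable_edist.pow_const p
  · rw [lintegral_finsetSum' _ fun x _ ↦ hX.aemeasurable_edist.pow_const p]
    calc ∑ x ∈ K, ∫⁻ ω, edist (X x.1 ω) (X x.2 ω) ^ p ∂P
      _ ≤ ∑ _x ∈ K, M * (m * ρ) ^ q := by
        refine Finset.sum_le_sum fun x hx ↦ (hX.kolmogorovCondition _ _).trans ?_
        gcongr
        · exact hX.q_pos.le
        · exact hKρ x.1 x.2 hx
      _ = M * (K.card * (m * ρ) ^ q) := by
        rw [Finset.sum_const, nsmul_eq_mul]; ring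
      _ ≤ _ := by gcongr
  · intro ω s hs t ht hst
    have hp := hX.p_pos
    have h : edist (X s ω) (X t ω) ≤ 2 * ⨆ x : K, edist (X x.1.1 ω) (X x.1.2 ω) :=
      (le_iSup₂_of_le (⟨s, hs⟩ : A) ⟨⟨t, ht⟩, hst⟩ le_rfl).trans (hKE fun t ↦ X t ω)
    calc edist (X s ω) (X t ω) ^ p
      _ ≤ (2 * ⨆ x : K, edist (X x.1.1 ω) (X x.1.2 ω)) ^ p := by gcongr
      _ = 2 ^ p * (⨆ x : K, edist (X x.1.1 ω) (X x.1.2 ω)) ^ p :=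
        ENNReal.mul_rpow_of_nonneg _ _ hp.le
      _ ≤ _ := by
        gcongr
        rw [← ENNReal.le_rpow_inv_iff hp]
        refine iSup_le fun x ↦ ?_
        rw [ENNReal.le_rpow_inv_iff hp]
        exact Finset.single_le_sum (f := fun x ↦ edist (X x.1 ω) (X x.2 ω) ^ p)
          (fun _ _ ↦ zero_le) x.2

/-! ### Summability of the chaining bounds -/

lemma summable_rpow_mul_geometric (h e : ℕ) (q : ℝ) (hq : 0 ≤ q) {ρ : ℝ} (hρ0 : 0 < ρ)
    (hρ : ρ < 1) : Summable fun k : ℕ ↦ ((h + k * e : ℕ) : ℝ) ^ q * ρ ^ k := by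
  obtain ⟨Q, hQ⟩ := exists_nat_ge q
  have hs : Summable fun k : ℕ ↦ ((k : ℝ) + 1) ^ Q * ρ ^ k := by
    have h0 := summable_pow_mul_geometric_of_norm_lt_one (R := ℝ) Q (r := ρ)
      (by rwa [Real.norm_of_nonneg hρ0.le])
    have h1 := ((summable_nat_add_iff 1).mpr h0).mul_right ρ⁻¹
    refine h1.congr fun k ↦ ?_
    rw [pow_succ]
    push_cast
    field_simp
  refine Summable.of_nonneg_of_le (fun k ↦ by positivity) (fun k ↦ ?_)
    (hs.mul_left (((h + e : ℕ) : ℝ) ^ q))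
  rw [← mul_assoc]
  gcongr
  calc ((h + k * e : ℕ) : ℝ) ^ q ≤ (((h + e : ℕ) : ℝ) * ((k : ℝ) + 1)) ^ q := by
        gcongr
        push_cast
        nlinarith [(by positivity : (0 : ℝ) ≤ h * k), (by positivity : (0 : ℝ) ≤ e)]
    _ = ((h + e : ℕ) : ℝ) ^ q * ((k : ℝ) + 1) ^ q := Real.mul_rpow (by positivity) (by positivity)
    _ ≤ _ := by
      gcongr
      rw [← Real.rpow_natCast]
      exact Real.rpow_le_rpow_of_exponent_le (by simp) hQ

/-- The `k`-th term bounds the expected contribution of scale `δ / 2 ^ k` to the `β`-Hölder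
seminorm: the inverse of the weight `2 ^ (-β * k * p)`, a bound `2 * (b * 2 ^ (d * k))` for the
number of pairs, and the moment bound for pairs at distance at most
`(h + k * e) * (4 * (δ / 2 ^ k))`. Up to the polynomial factor `(h + k * e) ^ q` it decays like
`2 ^ ((β * p + d - q) * k)`. -/
lemma summable_chaining_bound (b δ : ℝ≥0) (h e : ℕ) {d p q β : ℝ} (hp : 0 < p) (hq : 0 ≤ q)
    (hβ : β < (q - d) / p) :
    Summable fun k : ℕ ↦ ((((2 : ℝ≥0) ^ (-β)) ^ k) ^ p)⁻¹ *
      (2 * (b * ((2 : ℝ≥0) ^ d) ^ k) * (((h + k * e : ℕ) : ℝ≥0) * (4 * (δ / 2 ^ k))) ^ q) := by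
  have hρ : (2 : ℝ) ^ (β * p + d - q) < 1 := by
    apply Real.rpow_lt_one_of_one_lt_of_neg (by norm_num)
    rw [lt_div_iff₀ hp] at hβ
    linarith
  have hs := (summable_rpow_mul_geometric h e q hq (by positivity) hρ).mul_left
    (2 * b * (4 * δ) ^ q : ℝ)
  rw [← NNReal.summable_coe]
  refine hs.congr fun k ↦ ?_
  push_cast
  have e1 : (((((2 : ℝ) ^ (-β)) ^ k) ^ p)⁻¹) = 2 ^ (β * p * k) := by
    rw [← Real.rpow_natCast, ← Real.rpow_mul (by positivity), ← Real.rpow_mul (by positivity),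
      ← Real.rpow_neg (by positivity)]
    congr 1; ring
  have e2 : (2 ^ k : ℝ) = 2 ^ (k : ℝ) := (Real.rpow_natCast _ _).symm
  have e3 : ((2 : ℝ) ^ (β * p + d - q)) ^ k = 2 ^ (β * p * k) * 2 ^ (d * k) * (2 ^ (k * q))⁻¹ := by
    rw [← Real.rpow_natCast, ← Real.rpow_mul (by norm_num), ← Real.rpow_neg (by norm_num),
      ← Real.rpow_add (by norm_num), ← Real.rpow_add (by norm_num)]
    congr 1; ring
  have e4 : ((2 : ℝ) ^ d) ^ k = 2 ^ (d * k) := by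
    rw [← Real.rpow_natCast, ← Real.rpow_mul (by norm_num)]
  have e5 : (((h : ℝ) + k * e) * (4 * (δ / 2 ^ k))) ^ q
      = ((h : ℝ) + k * e) ^ q * ((4 * δ) ^ q * (2 ^ (k * q))⁻¹) := by
    rw [Real.mul_rpow (by positivity) (by positivity), ← mul_div_assoc,
      Real.div_rpow (by positivity) (by positivity), e2, ← Real.rpow_mul (by norm_num),
      div_eq_mul_inv]
  rw [e1, e3, e4, e5]
  ring

/-! ### Chaining along dyadic nets -/

/-- Suppose that `f` has increments at most `V * r ^ k` between points of `A k` at distance at most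
`4 * ε k`, and that `f t` is the limit of `f (π k t)`, where `π k t` is within `ε k` of `t` and both
`π k t` and `π (k + 1) t` lie in `A k`. Then the telescoping sums from scale `n` onwards bound the
increments of `f` over distances at most `ε n`. -/
lemma edist_le_of_chaining {T E : Type*} [PseudoEMetricSpace T] [PseudoEMetricSpace E]
    {f : T → E} {ε : ℕ → ℝ≥0∞} (hε : Antitone ε) {A : ℕ → Set T} {π : ℕ → T → T}
    (hπA : ∀ k t, π k t ∈ A k) (hπA' : ∀ k t, π (k + 1) t ∈ A k)
    (hπ : ∀ k t, edist t (π k t) ≤ ε k) {V r : ℝ≥0∞}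
    (hf : ∀ k, ∀ a ∈ A k, ∀ b ∈ A k, edist a b ≤ 4 * ε k → edist (f a) (f b) ≤ V * r ^ k)
    {s t : T} (hs : Tendsto (fun k ↦ f (π k s)) atTop (𝓝 (f s)))
    (ht : Tendsto (fun k ↦ f (π k t)) atTop (𝓝 (f t))) {n : ℕ} (hst : edist s t ≤ ε n) :
    edist (f s) (f t) ≤ (1 + 2 * (1 - r)⁻¹) * (V * r ^ n) := by
  have hε4 (k : ℕ) : 3 * ε k ≤ 4 * ε k := by gcongr; norm_num
  have key {u : T} (hu : Tendsto (fun k ↦ f (π k u)) atTop (𝓝 (f u))) :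
      edist (f (π n u)) (f u) ≤ V * r ^ n / (1 - r) := by
    refine edist_le_of_edist_le_geometric_of_tendsto r V (fun k ↦ ?_) hu n
    refine hf k _ (hπA k u) _ (hπA' k u) (le_trans ?_ (hε4 k))
    calc edist (π k u) (π (k + 1) u) ≤ edist u (π k u) + edist u (π (k + 1) u) :=
          edist_triangle_left _ _ _
      _ ≤ ε k + ε k := add_le_add (hπ k u) ((hπ (k + 1) u).trans (hε k.le_succ))
      _ ≤ 3 * ε k := by rw [← two_mul]; gcongr; norm_num
  have hmid : edist (f (π n s)) (f (π n t)) ≤ V * r ^ n := by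
    refine hf n _ (hπA n s) _ (hπA n t) (le_trans ?_ (hε4 n))
    calc edist (π n s) (π n t) ≤ edist (π n s) s + edist s t + edist t (π n t) :=
          edist_triangle4 _ _ _ _
      _ ≤ ε n + ε n + ε n := by
        rw [edist_comm (π n s)]
        exact add_le_add (add_le_add (hπ n s) hst) (hπ n t)
      _ = 3 * ε n := by ring
  calc edist (f s) (f t)
    _ ≤ edist (f s) (f (π n s)) + edist (f (π n s)) (f (π n t)) + edist (f (π n t)) (f t) :=
      edist_triangle4 _ _ _ _
    _ ≤ V * r ^ n / (1 - r) + V * r ^ n + V * r ^ n / (1 - r) := by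
      rw [edist_comm (f s)]
      exact add_le_add (add_le_add (key hs) hmid) (key ht)
    _ = _ := by rw [div_eq_mul_inv]; ring

/-! ### Almost sure behaviour on countable sets -/

namespace ProbabilityTheory.IsAEKolmogorovProcess

variable {T Ω E : Type*} [PseudoEMetricSpace T] [PseudoEMetricSpace E] [MeasurableSpace Ω]
  {P : Measure Ω} {X : T → Ω → E} {p q : ℝ} {M : ℝ≥0}

lemma ae_tendsto (hX : IsAEKolmogorovProcess X P p q M) {u : ℕ → T} {t : T}
    (hu : ∑' k, edist (u k) t ^ q ≠ ∞) :
    ∀ᵐ ω ∂P, Tendsto (fun k ↦ X (u k) ω) atTop (𝓝 (X t ω)) := by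
  have hmeas (k : ℕ) : AEMeasurable (fun ω ↦ edist (X (u k) ω) (X t ω) ^ p) P :=
    hX.aemeasurable_edist.pow_const p
  have hfin : ∫⁻ ω, ∑' k, edist (X (u k) ω) (X t ω) ^ p ∂P ≠ ∞ := by
    rw [lintegral_tsum hmeas]
    refine ne_top_of_le_ne_top (ENNReal.mul_ne_top (by simp : (M : ℝ≥0∞) ≠ ∞) hu) ?_
    rw [← ENNReal.tsum_mul_left]
    exact ENNReal.tsum_le_tsum fun k ↦ hX.kolmogorovCondition _ _
  filter_upwards [ae_lt_top' (AEMeasurable.tsum hmeas) hfin] with ω hω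
  rw [tendsto_iff_edist_tendsto_0]
  have h := (ENNReal.tendsto_atTop_zero_of_tsum_ne_top hω.ne).ennrpow_const p⁻¹
  simpa [← ENNReal.rpow_mul, mul_inv_cancel₀ hX.p_pos.ne',
    ENNReal.zero_rpow_of_pos (inv_pos.mpr hX.p_pos)] using h

lemma ae_edist_eq_zero (hX : IsAEKolmogorovProcess X P p q M) {T' : Set T} (hT' : T'.Countable) :
    ∀ᵐ ω ∂P, ∀ s ∈ T', ∀ t ∈ T', edist s t = 0 → edist (X s ω) (X t ω) = 0 := by
  refine (ae_ball_iff hT').mpr fun s _ ↦ (ae_ball_iff hT').mpr fun t _ ↦ ?_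
  by_cases h : edist s t = 0
  · filter_upwards [hX.edist_eq_zero h] with ω hω _ using hω
  · exact ae_of_all _ fun ω h' ↦ absurd h' h

end ProbabilityTheory.IsAEKolmogorovProcess

/-! ### Moment bound for the Hölder seminorm -/

/-- The set `A k` is the union of minimal covers at the scales `δ / 2 ^ k` and `δ / 2 ^ (k + 1)`, so
that it contains both ends of the chaining link from `π k t` to `π (k + 1) t`. -/
lemma HasBoundedCoveringNumber.exists_chaining_sets {T : Type*} [PseudoEMetricSpace T] {c : ℝ≥0}
    {d : ℝ} (hT : HasBoundedCoveringNumber (Set.univ : Set T) c d) (hd : 0 < d) {δ : ℝ≥0}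
    (hδ : 0 < δ) (hle : (δ : ℝ≥0∞) ≤ Metric.ediam (Set.univ : Set T)) :
    ∃ (A : ℕ → Finset T) (π : ℕ → T → T),
      (∀ k t, π k t ∈ A k) ∧ (∀ k t, π (k + 1) t ∈ A k) ∧
      (∀ k t, edist t (π k t) ≤ (δ / 2 ^ k : ℝ≥0)) ∧
      ∀ k, ((A k).card : ℝ≥0) ≤ 2 * c * (δ / 2) ^ (-d) * ((2 : ℝ≥0) ^ d) ^ k := by
  classical
  have hε (k : ℕ) : 0 < δ / 2 ^ k := by positivity
  have hεle (k : ℕ) : ((δ / 2 ^ k : ℝ≥0) : ℝ≥0∞) ≤ Metric.ediam (Set.univ : Set T) := by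
    refine le_trans ?_ hle
    exact ENNReal.coe_le_coe.mpr (div_le_self zero_le (one_le_pow₀ one_le_two))
  choose S hS hScard using fun k ↦ hT.exists_finset (hε k) (hεle k)
  choose π hπS hπ using hS
  refine ⟨fun k ↦ S k ∪ S (k + 1), π, fun k t ↦ Finset.mem_union_left _ (hπS k t),
    fun k t ↦ Finset.mem_union_right _ (hπS (k + 1) t), hπ, fun k ↦ ?_⟩
  have hcard (k : ℕ) : ((S k).card : ℝ≥0) ≤ c * (δ / 2 ^ k) ^ (-d) := by
    have h := hScard k
    rw [← ENNReal.coe_rpow_of_ne_zero (hε k).ne'] at h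
    exact_mod_cast h
  have heq : (δ / 2 ^ (k + 1)) ^ (-d) = (δ / 2) ^ (-d) * ((2 : ℝ≥0) ^ d) ^ k := by
    rw [pow_succ', ← div_div, div_eq_mul_inv (δ / 2), NNReal.mul_rpow, NNReal.inv_rpow,
      NNReal.rpow_neg (2 ^ k), inv_inv, ← NNReal.rpow_natCast, ← NNReal.rpow_natCast,
      ← NNReal.rpow_mul, ← NNReal.rpow_mul, mul_comm d]
  have hmono : (δ / 2 ^ k) ^ (-d) ≤ (δ / 2 ^ (k + 1)) ^ (-d) := by
    rw [NNReal.rpow_neg, NNReal.rpow_neg]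
    have := NNReal.rpow_pos (p := d) (hε (k + 1))
    gcongr
    · exact one_le_two
    · exact k.le_succ
  calc ((S k ∪ S (k + 1)).card : ℝ≥0) ≤ (S k).card + (S (k + 1)).card := by
        exact_mod_cast Finset.card_union_le _ _
    _ ≤ c * (δ / 2 ^ (k + 1)) ^ (-d) + c * (δ / 2 ^ (k + 1)) ^ (-d) :=
      add_le_add ((hcard k).trans (by gcongr)) (hcard (k + 1))
    _ = _ := by rw [heq]; ring

/-- The `p`-th moment of the `β`-Hölder seminorm of a Kolmogorov process on a countable set is at
most `M` times a constant depending only on the index space and the exponents. -/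
theorem exists_lintegral_iSup_edist_rpow_div_le {T : Type*} [PseudoEMetricSpace T] {c : ℝ≥0}
    {d p q : ℝ} (hd : 0 < d) (hp : 0 < p) (hdq : d < q)
    (hT : HasBoundedCoveringNumber (Set.univ : Set T) c d) {β : ℝ} (hβ0 : 0 < β)
    (hβ : β < (q - d) / p) :
    ∃ L : ℝ≥0, ∀ (E : Type*) [PseudoEMetricSpace E] (Ω : Type*) [MeasurableSpace Ω]
      (P : Measure Ω) (X : T → Ω → E) (M : ℝ≥0), IsAEKolmogorovProcess X P p q M →
      ∀ T' : Set T, T'.Countable →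
        ∫⁻ ω, ⨆ (s : T') (t : T'),
          edist (X s ω) (X t ω) ^ p / edist (s : T) (t : T) ^ (β * p) ∂P ≤ M * L := by
  have hq : 0 < q := hd.trans hdq
  have hdiam := hT.ediam_ne_top hd
  have hle_diam (s t : T) : edist s t ≤ Metric.ediam (Set.univ : Set T) :=
    Metric.edist_le_ediam_of_mem (Set.mem_univ _) (Set.mem_univ _)
  lift Metric.ediam (Set.univ : Set T) to ℝ≥0 using hdiam with δ hδeq
  rcases eq_zero_or_pos δ with rfl | hδ
  -- On an index space of diameter zero all increments vanish almost surely.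
  · refine ⟨0, fun E _ Ω _ P X M hX T' hT' ↦ le_of_eq ?_⟩
    rw [ENNReal.coe_zero, mul_zero]
    refine (lintegral_congr_ae ?_).trans lintegral_zero
    filter_upwards [hX.ae_edist_eq_zero hT'] with ω hω
    simp only [ENNReal.iSup_eq_zero]
    intro s t
    simp [hω s s.2 t t.2 (by simpa using hle_diam s t), hp]
  obtain ⟨A, π, hπA, hπA', hπ, hAcard⟩ := hT.exists_chaining_sets hd hδ hδeq.le
  set b : ℝ≥0 := 2 * c * (δ / 2) ^ (-d)
  obtain ⟨h, hh⟩ : ∃ h : ℕ, b < 2 ^ h := pow_unbounded_of_one_lt b one_lt_two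
  set e := ⌈d⌉₊
  -- Pair reduction with base `2` stretches distances by the exponent, which grows linearly in `k`.
  have hA2 (k : ℕ) : (A k).card ≤ 2 ^ (h + k * e) := by
    have h2 : (2 : ℝ≥0) ^ d ≤ 2 ^ e := by
      rw [← NNReal.rpow_natCast]
      exact NNReal.rpow_le_rpow_of_exponent_le one_le_two (Nat.le_ceil d)
    have : ((A k).card : ℝ≥0) ≤ 2 ^ (h + k * e) := by
      refine (hAcard k).trans ?_
      rw [pow_add, mul_comm k, pow_mul]
      gcongr
    exact_mod_cast this
  set r : ℝ≥0 := 2 ^ (-β)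
  have hr0 : 0 < r := NNReal.rpow_pos two_pos
  have hr1 : r < 1 := NNReal.rpow_lt_one_of_one_lt_of_neg one_lt_two (by linarith)
  set w : ℕ → ℝ≥0 := fun k ↦ (r ^ k) ^ p
  have hw (k : ℕ) : 0 < w k := NNReal.rpow_pos (by positivity)
  set Λ : ℝ≥0 := ∑' k : ℕ,
    (w k)⁻¹ * (2 * (b * ((2 : ℝ≥0) ^ d) ^ k) * (((h + k * e : ℕ) : ℝ≥0) * (4 * (δ / 2 ^ k))) ^ q)
  have hΛ := summable_chaining_bound b δ h e hp hq.le hβ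
  set C : ℝ≥0 := 1 + 2 * (1 - r)⁻¹
  set D : ℝ≥0 := C ^ p * 2 ^ p * (2 / δ) ^ (β * p)
  refine ⟨D * Λ, fun E _ Ω _ P X M hX T' hT' ↦ ?_⟩
  choose G hGm hGint hG using fun k ↦
    exists_aemeasurable_edist_rpow_le hX (A k) (h + k * e) (hA2 k) (4 * (δ / 2 ^ k : ℝ≥0))
  -- `G k` dominates the increments at scale `k`; the weighted sum `W` is the `p`-th power of a
  -- Hölder constant, up to the deterministic factor `D`.
  set W : Ω → ℝ≥0∞ := fun ω ↦ ∑' k, ((w k)⁻¹ : ℝ≥0) * G k ω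
  have hWint : ∫⁻ ω, W ω ∂P ≤ M * Λ := by
    rw [lintegral_tsum fun k ↦ (hGm k).const_mul _, ENNReal.coe_tsum hΛ, ← ENNReal.tsum_mul_left]
    refine ENNReal.tsum_le_tsum fun k ↦ ?_
    rw [lintegral_const_mul'' _ (hGm k)]
    calc ((w k)⁻¹ : ℝ≥0) * ∫⁻ ω, G k ω ∂P
      _ ≤ ((w k)⁻¹ : ℝ≥0) * (M * (2 * ((A k).card : ℝ≥0) *
          (((h + k * e : ℕ) : ℝ≥0) * (4 * (δ / 2 ^ k : ℝ≥0) : ℝ≥0) : ℝ≥0) ^ q)) := by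
        gcongr
        simpa using hGint k
      _ ≤ ((w k)⁻¹ : ℝ≥0) * (M * (2 * (b * ((2 : ℝ≥0) ^ d) ^ k : ℝ≥0) *
          (((h + k * e : ℕ) : ℝ≥0) * (4 * (δ / 2 ^ k : ℝ≥0) : ℝ≥0) : ℝ≥0) ^ q)) := by
        gcongr
        exact_mod_cast hAcard k
      _ = _ := by
        rw [← ENNReal.coe_rpow_of_nonneg _ hq.le]
        push_cast
        ring
  have hεsum : ∑' k : ℕ, ((δ / 2 ^ k : ℝ≥0) : ℝ≥0∞) ^ q ≠ ∞ := by
    have h2 : (2⁻¹ : ℝ≥0) ^ q < 1 := NNReal.rpow_lt_one (by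
      rw [← NNReal.coe_lt_coe]; norm_num) hq
    have (k : ℕ) : ((δ / 2 ^ k : ℝ≥0) : ℝ≥0∞) ^ q = (δ ^ q * ((2⁻¹ : ℝ≥0) ^ q) ^ k : ℝ≥0) := by
      rw [← ENNReal.coe_rpow_of_nonneg _ hq.le, div_eq_mul_inv, NNReal.mul_rpow, ← inv_pow,
        ← NNReal.rpow_natCast, ← NNReal.rpow_natCast, ← NNReal.rpow_mul, ← NNReal.rpow_mul,
        mul_comm q]
    simp_rw [this]
    rw [ENNReal.tsum_coe_ne_top_iff_summable]
    exact (NNReal.summable_geometric h2).mul_left _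
  have hlim : ∀ᵐ ω ∂P, ∀ t ∈ T', Tendsto (fun k ↦ X (π k t) ω) atTop (𝓝 (X t ω)) := by
    refine (ae_ball_iff hT').mpr fun t _ ↦ hX.ae_tendsto (ne_top_of_le_ne_top hεsum ?_)
    refine ENNReal.tsum_le_tsum fun k ↦ ?_
    gcongr
    rw [edist_comm]
    exact hπ k t
  calc _ ≤ ∫⁻ ω, D * W ω ∂P := lintegral_mono_ae ?_
    _ = D * ∫⁻ ω, W ω ∂P := lintegral_const_mul' _ _ ENNReal.coe_ne_top
    _ ≤ D * (M * Λ) := by gcongr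
    _ = _ := by push_cast; ring
  filter_upwards [hlim, hX.ae_edist_eq_zero hT'] with ω hω hω0
  refine iSup₂_le fun ⟨s, hs⟩ ⟨t, ht⟩ ↦ ENNReal.div_le_of_le_mul ?_
  by_cases hst0 : edist s t = 0
  · simp [hω0 s hs t ht hst0, hp]
  have hGW (k : ℕ) : G k ω ≤ w k * W ω := by
    calc G k ω = w k * (((w k)⁻¹ : ℝ≥0) * G k ω) := by
          rw [← mul_assoc, ← ENNReal.coe_mul, mul_inv_cancel₀ (hw k).ne', ENNReal.coe_one, one_mul]
      _ ≤ _ := by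
        gcongr
        exact ENNReal.le_tsum k
  have hchain (k : ℕ) (x : T) (hx : x ∈ A k) (y : T) (hy : y ∈ A k)
      (hxy : edist x y ≤ 4 * (δ / 2 ^ k : ℝ≥0)) :
      edist (X x ω) (X y ω) ≤ (2 * W ω ^ p⁻¹) * (r : ℝ≥0∞) ^ k := by
    rw [← ENNReal.rpow_le_rpow_iff hp]
    refine (hG k ω x hx y hy hxy).trans ?_
    rw [ENNReal.mul_rpow_of_nonneg _ _ hp.le, ENNReal.mul_rpow_of_nonneg _ _ hp.le,
      ENNReal.rpow_inv_rpow hp.ne', mul_assoc]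
    gcongr
    refine (hGW k).trans_eq ?_
    rw [mul_comm, ← ENNReal.coe_pow, ← ENNReal.coe_rpow_of_nonneg _ hp.le]
  obtain ⟨x, hx⟩ : ∃ x : ℝ≥0, edist s t = x :=
    ⟨_, (ENNReal.coe_toNNReal (ne_top_of_le_ne_top ENNReal.coe_ne_top (hle_diam s t))).symm⟩
  have hxδ : x ≤ δ := by
    have := hle_diam s t
    rw [hx] at this
    exact_mod_cast this
  have hx0 : 0 < x := by
    rw [pos_iff_ne_zero]
    rintro rfl
    simp [hx] at hst0
  -- The scale `n` is the one with `δ / 2 ^ (n + 1) < edist s t ≤ δ / 2 ^ n`.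
  obtain ⟨n, hn1, hn2⟩ := exists_nat_pow_near_of_lt_one (x := x / δ) (y := (2⁻¹ : ℝ≥0))
    (by positivity) (div_le_one_of_le₀ hxδ zero_le) (by positivity)
    (by rw [← NNReal.coe_lt_coe]; norm_num)
  have hxn : x ≤ δ / 2 ^ n := by
    rw [div_le_iff₀ hδ, inv_pow] at hn2
    rwa [div_eq_mul_inv, mul_comm]
  have hrn : r ^ n ≤ (2 / δ * x) ^ β := by
    have : r ^ n = (2⁻¹ ^ n) ^ β := by
      rw [← NNReal.rpow_natCast, ← NNReal.rpow_natCast, ← NNReal.rpow_mul, ← NNReal.rpow_mul,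
        NNReal.inv_rpow, ← NNReal.rpow_neg]
      congr 1; ring
    rw [this]
    gcongr
    rw [pow_succ, ← div_eq_mul_inv, div_lt_iff₀ two_pos] at hn1
    exact hn1.le.trans_eq (by ring)
  have hεanti : Antitone fun k : ℕ ↦ ((δ / 2 ^ k : ℝ≥0) : ℝ≥0∞) := by
    intro i j hij
    simp only [ENNReal.coe_le_coe]
    gcongr
    exact one_le_two
  have hbound := edist_le_of_chaining (A := fun k ↦ (A k : Set T)) (r := (r : ℝ≥0∞)) hεanti
    hπA hπA' hπ hchain (hω s hs) (hω t ht)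
    (n := n) (by rw [hx]; exact_mod_cast hxn)
  have hC : (1 + 2 * (1 - (r : ℝ≥0∞))⁻¹) = C := by
    have : 1 - r ≠ 0 := (tsub_pos_of_lt hr1).ne'
    simp [C, ENNReal.coe_inv this]
  rw [hC] at hbound
  calc edist (X s ω) (X t ω) ^ p
    _ ≤ (C * ((2 * W ω ^ p⁻¹) * ((2 / δ * x) ^ β : ℝ≥0))) ^ p := by
      refine ENNReal.rpow_le_rpow (hbound.trans ?_) hp.le
      gcongr
      exact_mod_cast hrn
    _ = D * W ω * edist s t ^ (β * p) := by
      rw [ENNReal.mul_rpow_of_nonneg _ _ hp.le, ENNReal.mul_rpow_of_nonneg _ _ hp.le,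
        ENNReal.mul_rpow_of_nonneg _ _ hp.le, ENNReal.rpow_inv_rpow hp.ne', hx,
        ← ENNReal.coe_rpow_of_nonneg _ hp.le, ← ENNReal.coe_rpow_of_nonneg _ hp.le,
        ← ENNReal.coe_rpow_of_nonneg _ (by positivity), ← NNReal.rpow_mul, NNReal.mul_rpow,
        show (2 : ℝ≥0∞) = (2 : ℝ≥0) by rfl, ← ENNReal.coe_rpow_of_nonneg _ hp.le]
      simp only [D, ENNReal.coe_mul]
      ring

/-! ### Construction of the Hölder modification -/

lemma exists_holderOnWith_of_iSup_ne_top {T E : Type*} [PseudoEMetricSpace T]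
    [PseudoEMetricSpace E] (hT : Metric.ediam (Set.univ : Set T) ≠ ∞) {f : T → E} {p : ℝ}
    (hp : 0 < p) {β : ℝ≥0} {T' : Set T}
    (h : ⨆ (s : T') (t : T'), edist (f s) (f t) ^ p / edist (s : T) (t : T) ^ (β * p) ≠ ∞) :
    ∃ C : ℝ≥0, HolderOnWith C β f T' := by
  set F := ⨆ (s : T') (t : T'), edist (f s) (f t) ^ p / edist (s : T) (t : T) ^ (β * p) with hF
  have hF' : F ^ p⁻¹ ≠ ∞ := ENNReal.rpow_ne_top_of_nonneg (inv_nonneg.mpr hp.le) h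
  refine ⟨(F ^ p⁻¹).toNNReal, fun s hs t ht ↦ ?_⟩
  rw [ENNReal.coe_toNNReal hF', ← ENNReal.rpow_le_rpow_iff hp,
    ENNReal.mul_rpow_of_nonneg _ _ hp.le, ENNReal.rpow_inv_rpow hp.ne', ← ENNReal.rpow_mul]
  have hst : edist s t ≠ ∞ := ne_top_of_le_ne_top hT
    (Metric.edist_le_ediam_of_mem (Set.mem_univ _) (Set.mem_univ _))
  have hle : edist (f s) (f t) ^ p / edist s t ^ (β * p) ≤ F :=
    le_iSup₂_of_le (⟨s, hs⟩ : T') (⟨t, ht⟩ : T') le_rfl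
  exact (ENNReal.div_le_iff_le_mul (Or.inr h)
    (Or.inl (ENNReal.rpow_ne_top_of_nonneg (by positivity) hst))).mp hle

lemma HolderOnWith.tendsto_of_tendsto {T E : Type*} [PseudoEMetricSpace T] [PseudoEMetricSpace E]
    {f : T → E} {C β : ℝ≥0} {S : Set T} (hf : HolderOnWith C β f S) (hβ : 0 < β) {u : ℕ → T}
    {t : T} (hu : ∀ k, u k ∈ S) (ht : t ∈ S) (hut : Tendsto u atTop (𝓝 t)) :
    Tendsto (fun k ↦ f (u k)) atTop (𝓝 (f t)) :=
  (hf.continuousOn hβ t ht).tendsto.comp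
    (tendsto_nhdsWithin_iff.mpr ⟨hut, Eventually.of_forall hu⟩)

lemma HolderOnWith.cauchySeq_comp {T E : Type*} [PseudoEMetricSpace T] [PseudoEMetricSpace E]
    {f : T → E} {C β : ℝ≥0} {S : Set T} (hf : HolderOnWith C β f S) (hβ : 0 < β) {u : ℕ → T}
    (hu : ∀ k, u k ∈ S) (hcu : CauchySeq u) : CauchySeq fun k ↦ f (u k) := by
  have hcu' : CauchySeq fun k ↦ (⟨u k, hu k⟩ : S) := by
    have h := EMetric.cauchySeq_iff.mp hcu
    exact EMetric.cauchySeq_iff.mpr h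
  exact (HolderWith.restrict_iff.mpr hf).uniformContinuous hβ |>.comp_cauchySeq hcu'

/-- Extending `f` from `S` by limits along arbitrary approximating sequences preserves the Hölder
constant. -/
lemma HolderOnWith.holderWith_of_tendsto {T E : Type*} [PseudoEMetricSpace T]
    [PseudoEMetricSpace E] {f g : T → E} {C β : ℝ≥0} {S : Set T} (hf : HolderOnWith C β f S)
    {u : T → ℕ → T} (hu : ∀ t k, u t k ∈ S) (hut : ∀ t, Tendsto (u t) atTop (𝓝 t))
    (hg : ∀ t, Tendsto (fun k ↦ f (u t k)) atTop (𝓝 (g t))) : HolderWith C β g := by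
  intro s t
  refine le_of_tendsto_of_tendsto' ((hg s).edist (hg t))
    (ENNReal.Tendsto.const_mul (((hut s).edist (hut t)).ennrpow_const β)
      (Or.inr ENNReal.coe_ne_top)) fun k ↦ ?_
  exact hf _ (hu s k) _ (hu t k)

/-- The modification extends the process by limits from a countable dense set, on the almost sure
event that the restriction to that set is Hölder for a sequence of exponents increasing to
`(q - d) / p`. -/
theorem exists_modification_holderWith {T Ω E : Type*} [PseudoEMetricSpace T]
    [SecondCountableTopology T] [PseudoEMetricSpace E] [MeasurableSpace E] [BorelSpace E]
    [CompleteSpace E] [MeasurableSpace Ω] {P : Measure Ω} [IsProbabilityMeasure P]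
    {c : ℝ≥0} {d p q : ℝ} (hd : 0 < d) (hp : 0 < p) (hdq : d < q)
    (hT : HasBoundedCoveringNumber (Set.univ : Set T) c d)
    {X : T → Ω → E} {M : ℝ≥0} (hX : IsAEKolmogorovProcess X P p q M) :
    ∃ Y : T → Ω → E, (∀ t, Measurable (Y t)) ∧ IsModificationOf Y X P ∧
      ∀ (ω : Ω) (β : ℝ≥0), 0 < β → (β : ℝ) < (q - d) / p →
        ∃ C : ℝ≥0, HolderWith C β (fun t ↦ Y t ω) := by
  classical
  rcases isEmpty_or_nonempty T with hTe | hTne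
  · exact ⟨X, isEmptyElim, isEmptyElim, fun ω β _ _ ↦ ⟨0, .of_isEmpty⟩⟩
  obtain ⟨x₀⟩ : Nonempty E := (nonempty_of_isProbabilityMeasure P).map (X (Classical.arbitrary T))
  set Z := hX.mk X
  have hZ : IsKolmogorovProcess Z P p q M := hX.IsKolmogorovProcess_mk
  have hdiam := hT.ediam_ne_top hd
  have hB : 0 < ((q - d) / p).toNNReal := Real.toNNReal_pos.mpr (div_pos (by linarith) hp)
  obtain ⟨β, -, hβ, hβlim⟩ := exists_seq_strictMono_tendsto' hB
  have hβ' (n : ℕ) : (β n : ℝ) < (q - d) / p := Real.lt_toNNReal_iff_coe_lt.mp (hβ n).2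
  obtain ⟨T', hT'c, hT'd⟩ := TopologicalSpace.exists_countable_dense T
  choose u huT' hu using fun t ↦ mem_closure_iff_seq_limit.mp (hT'd t)
  set F : Set T → ℕ → Ω → ℝ≥0∞ := fun S n ω ↦ ⨆ (s : S) (t : S),
    edist (Z s ω) (Z t ω) ^ p / edist (s : T) (t : T) ^ (β n * p)
  have hFm {S : Set T} (hS : S.Countable) (n : ℕ) : Measurable (F S n) := by
    have : Countable S := hS
    exact .iSup fun s ↦ .iSup fun t ↦ (hZ.measurable_edist.pow_const p).div_const _
  have hFfin {S : Set T} (hS : S.Countable) : ∀ᵐ ω ∂P, ∀ n, F S n ω < ∞ := by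
    refine ae_all_iff.mpr fun n ↦ ?_
    obtain ⟨L, hL⟩ := exists_lintegral_iSup_edist_rpow_div_le hd hp hdq hT (hβ n).1 (hβ' n)
    refine ae_lt_top (hFm hS n) (ne_top_of_le_ne_top ?_
      (hL E Ω P Z M hZ.IsAEKolmogorovProcess S hS))
    exact ENNReal.mul_ne_top ENNReal.coe_ne_top ENNReal.coe_ne_top
  set G : Set Ω := {ω | ∀ n, F T' n ω < ∞}
  have hG : MeasurableSet G := by
    simp only [G, Set.ofPred_forall]
    exact .iInter fun n ↦ measurableSet_lt (hFm hT'c n) measurable_const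
  have hFhol {S : Set T} {n : ℕ} {ω : Ω} (h : F S n ω < ∞) :
      ∃ C : ℝ≥0, HolderOnWith C (β n) (fun t ↦ Z t ω) S :=
    exists_holderOnWith_of_iSup_ne_top hdiam hp h.ne
  have hlim (t : T) (ω : Ω) : ∃ x, Tendsto (fun k ↦ if ω ∈ G then Z (u t k) ω else x₀) atTop (𝓝 x)
      := by
    by_cases hω : ω ∈ G
    · obtain ⟨C, hC⟩ := hFhol (hω 0)
      simpa [hω] using
        cauchySeq_tendsto_of_complete (hC.cauchySeq_comp (hβ 0).1 (huT' t) (hu t).cauchySeq)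
    · exact ⟨x₀, by simpa [hω] using tendsto_const_nhds⟩
  choose l hl using hlim
  have hlm (t : T) : Measurable (l t) :=
    measurable_of_tendsto_metrizable
      (fun k ↦ Measurable.ite hG (hZ.measurable (u t k)) measurable_const)
      (tendsto_pi_nhds.mpr (hl t))
  have hlG {ω : Ω} (hω : ω ∈ G) (t : T) : Tendsto (fun k ↦ Z (u t k) ω) atTop (𝓝 (l t ω)) := by
    simpa [hω] using hl t ω
  -- Limits in `E` are unique only up to distance zero, whereas a modification has to agree with the
  -- process exactly. Hence the limit `l t` is replaced by `Z t` wherever the two are at distance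
  -- zero; the `limsup` makes that event visibly measurable.
  set H : T → Set Ω := fun t ↦
    G ∩ {ω | limsup (fun k ↦ edist (Z (u t k) ω) (Z t ω)) atTop = 0}
  have hH (t : T) : MeasurableSet (H t) :=
    hG.inter ((Measurable.limsup fun k ↦ hZ.measurable_edist) (measurableSet_singleton 0))
  set Y : T → Ω → E := fun t ω ↦ if ω ∈ H t then Z t ω else l t ω
  have hYl (t : T) (ω : Ω) : edist (Y t ω) (l t ω) = 0 := by
    by_cases hω : ω ∈ H t
    · have h : Tendsto (fun k ↦ edist (Z (u t k) ω) (Z t ω)) atTop (𝓝 (edist (l t ω) (Z t ω))) :=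
        (hlG hω.1 t).edist tendsto_const_nhds
      simp only [Y, hω, if_true]
      rw [edist_comm, ← h.limsup_eq]
      exact hω.2
    · simp [Y, hω]
  refine ⟨Y, fun t ↦ Measurable.ite (hH t) (hZ.measurable t) (hlm t), fun t ↦ ?_,
    fun ω γ _ hγ ↦ ?_⟩
  -- Almost surely the process is Hölder on the dense set with the point `t` added, so that `Z t` is
  -- the limit of its values along the sequence approximating `t`.
  · filter_upwards [hFfin hT'c, hFfin (hT'c.insert t), hX.ae_eq_mk t] with ω hω hωt hXt
    obtain ⟨C, hC⟩ := hFhol (hωt 0)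
    have h := hC.tendsto_of_tendsto (hβ 0).1 (fun k ↦ Set.mem_insert_of_mem t (huT' t k))
      (Set.mem_insert t T') (hu t)
    have hωH : ω ∈ H t := ⟨hω, (tendsto_iff_edist_tendsto_0.mp h).limsup_eq⟩
    simp [Y, hωH, hXt, Z]
  · have hYY {C : ℝ≥0} (hC : HolderWith C γ (l · ω)) : HolderWith C γ (Y · ω) := fun s t ↦ by
      calc edist (Y s ω) (Y t ω)
        _ ≤ edist (Y s ω) (l s ω) + edist (l s ω) (l t ω) + edist (l t ω) (Y t ω) :=
          edist_triangle4 _ _ _ _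
        _ = edist (l s ω) (l t ω) := by rw [hYl, edist_comm (l t ω), hYl, zero_add, add_zero]
        _ ≤ _ := hC s t
    by_cases hω : ω ∈ G
    · have hγ' : γ < ((q - d) / p).toNNReal := Real.lt_toNNReal_iff_coe_lt.mpr hγ
      obtain ⟨n, hn⟩ := (hβlim.eventually_const_lt hγ').exists
      obtain ⟨C, hC⟩ := hFhol (hω n)
      have hl := hC.holderWith_of_tendsto huT' hu (hlG hω)
      lift Metric.ediam (Set.univ : Set T) to ℝ≥0 using hdiam with D hD
      refine ⟨_, hYY (hl.of_le (D := D) (fun s t ↦ ?_) hn.le)⟩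
      rw [hD]
      exact Metric.edist_le_ediam_of_mem (Set.mem_univ _) (Set.mem_univ _)
    · refine ⟨0, hYY fun s t ↦ ?_⟩
      have hl0 (t : T) : edist (l t ω) x₀ = 0 := by
        have h := (hl t ω).edist (tendsto_const_nhds (x := x₀))
        simp only [hω, if_false, edist_self] at h
        exact tendsto_nhds_unique h tendsto_const_nhds
      refine (edist_triangle_right _ _ x₀).trans ?_
      rw [hl0, hl0]
      simp

end

theorem mainTheorem2 {T : Type*} [PseudoEMetricSpace T] (c : ℝ≥0) (d p q : ℝ)
    (hc : 0 < c) (hd : 0 < d) (hp : 0 < p) (hdq : d < q)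
    (hT : HasBoundedCoveringNumber (Set.univ : Set T) c d) :
    (∀ β : ℝ, 0 < β → β < (q - d) / p → ∃ L : ℝ≥0,
      ∀ (E : Type*) [PseudoEMetricSpace E] (Ω : Type*) [MeasurableSpace Ω]
        (P : Measure Ω) [IsProbabilityMeasure P] (X : T → Ω → E) (M : ℝ≥0),
        IsAEKolmogorovProcess X P p q M →
        ∀ T' : Set T, T'.Countable →
          ∫⁻ ω, ⨆ (s : T') (t : T'),
            edist (X s ω) (X t ω) ^ p / edist (s : T) (t : T) ^ (β * p) ∂P ≤ M * L) ∧
    (∀ (E : Type*) [PseudoEMetricSpace E] [MeasurableSpace E] [BorelSpace E] (Ω : Type*)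
        [MeasurableSpace Ω] (P : Measure Ω) [IsProbabilityMeasure P] (X : T → Ω → E) (M : ℝ≥0),
        IsAEKolmogorovProcess X P p q M →
        CompleteSpace E → SecondCountableTopology T →
        ∃ Y : T → Ω → E, (∀ t, Measurable (Y t)) ∧ IsModificationOf Y X P ∧
          ∀ (ω : Ω) (β : ℝ≥0), 0 < β → (β : ℝ) < (q - d) / p →
            ∃ C : ℝ≥0, HolderWith C β (fun t ↦ Y t ω)) :=
  ⟨fun _ hβ0 hβ ↦ by
    obtain ⟨L, hL⟩ := exists_lintegral_iSup_edist_rpow_div_le hd hp hdq hT hβ0 hβ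
    exact ⟨L, fun E _ Ω _ P _ X M hX ↦ hL E Ω P X M hX⟩,
  fun _ _ _ _ _ _ _ _ _ _ hX _ _ ↦ exists_modification_holderWith hd hp hdq hT hX⟩
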